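/- Let $U,n_t\ge 1$ be integers. Let $K\subset\mathbb{C}$ be an imaginary quadratic field of class number $1$, let $L=K(\alpha)$ with $\alpha\in\mathbb{R}$ be a cyclic Galois extension of $K$ of degree $Un_t$, let $\sigma$ be a generator of $\mathrm{Gal}(L/K)$, and let $p\in\mathcal{O}_K$ be a prime element that is inert in $L/K$ (that is, $p\mathcal{O}_L$ is a prime ideal). Put $\tau=\sigma^U$ and let $m$ be an integer with $m>\frac{U(n_t-1)}{2}$. For $x_1,\dots,x_{n_t}\in\mathcal{O}_L$ let $M(x_1,\dots,x_{n_t})$ be the $n_t\times n_t$ matrix whose entry in row $i$ and column $j$ ($1\le i,j\le n_t$) is $\tau^{j-1}(x_{i-j+1})$ if $j\le i$ and $p\,\tau^{j-1}(x_{n_t+i-j+1})$ if $i<j$ (the left regular representation of the cyclic algebra $(L/F,\tau,p)$, where $F$ is the fixed field of $\tau$). For $1\le j\le U$ let $\mathbf{L}_j\subset M_{n_t\times Un_t}(\mathbb{C})$ be the lattice of all matrices $$\left(M,\ \sigma(M),\ \dots,\ p^{-m}\sigma^{j-1}(M),\ \dots,\ \sigma^{U-1}(M)\right),\qquad M=M(x_1,\dots,x_{n_t}),\quad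 x_1,\dots,x_{n_t}\in\mathcal{O}_L,$$ in which only the $j$-th block $\sigma^{j-1}(M)$ is multiplied by $p^{-m}$. Fix a $\mathbb{Z}$-basis $B_{j,1},\dots,B_{j,r}$ of each $\mathbf{L}_j$, and for real $N\ge 1$ put $$\mathbf{L}_j(N)=\Big\{\sum_{s=1}^{r}b_sB_{j,s}\ :\ b_s\in\mathbb{Z},\ -N\le b_s\le N\Big\}.$$ For a nonempty set $\mathcal{I}_u=\{i_1,\dots,i_u\}\subseteq\{1,\dots,U\}$ of size $u$ and real numbers $N_{i_1},\dots,N_{i_u}\ge 1$ define $$D_{\mathcal{I}_u}(N_{i_1},\dots,N_{i_u})=\min_{X_{i_j}\in\mathbf{L}_{i_j}(N_{i_j})\setminus\{0\}}\sqrt{\det(XX^{\dagger})},$$ where $X$ is the $un_t\times Un_t$ matrix obtained by stacking $X_{i_1},\dots,X_{i_u}$ on top of each other, and write $D_{\mathcal{I}_u}(N)=D_{\mathcal{I}_u}(N,\dots,N)$. Then there is a constant $C>0$ (depending only on the code and the chosen bases) such that for all nonempty $\mathcal{I}_u\subseteq\{1,\dots,U\}$ and all real $N_{i_1},\dots,N_{i_u}\ge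 1$ $$D_{\mathcal{I}_u}(N_{i_1},\dots,N_{i_u})\ \ge\ \begin{cases}\dfrac{C}{(N_{i_1}\cdots N_{i_u})^{(U-1)n_t}} & \text{if } u>1,\\[2mm] C & \text{if } u=1.\end{cases}$$ In particular, for all real $N\ge 1$, $$D_{\mathcal{I}_u}(N)\ \ge\ \begin{cases}\dfrac{C}{N^{u(U-1)n_t}} & \text{if } u>1,\\[2mm] C & \text{if } u=1.\end{cases}$$ -/

import Mathlib

open scoped NumberField

noncomputable section

namespace MacCode

/-! ### Multi-user codes and the decay function -/

/-- The finite code `𝐋(N)`: integer combinations `∑ cᵢ Bᵢ` with `-N ≤ cᵢ ≤ N`, for the lattice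
with basis `B`. -/
def finiteCode {r n : ℕ} {κ : Type} (B : Fin r → Matrix (Fin n) κ ℂ) (N : ℝ) :
    Set (Matrix (Fin n) κ ℂ) :=
  {X | ∃ c : Fin r → ℤ, (∀ i, -N ≤ (c i : ℝ) ∧ (c i : ℝ) ≤ N) ∧ X = ∑ i, c i • B i}

/-- The matrix `M(X_{i₁}, …, X_{iᵤ})`: the codewords of the users in `I` on top of each other. -/
def stack {U n : ℕ} {κ : Type} {I : Finset (Fin U)} (X : I → Matrix (Fin n) κ ℂ) :
    Matrix (I × Fin n) κ ℂ :=
  Matrix.of fun a c => X a.1 a.2 c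

/-- The values `√det(M M†)`, where `M` stacks nonzero codewords `X_i ∈ 𝐋_i(N_i)`, `i ∈ I`.
The determinant of the positive semidefinite matrix `M M†` is a nonnegative real number, so that
taking its real part loses nothing. -/
def decaySet {U r n : ℕ} {κ : Type} [Fintype κ] (B : Fin U → Fin r → Matrix (Fin n) κ ℂ)
    (I : Finset (Fin U)) (N : I → ℝ) : Set ℝ :=
  {d | ∃ X : I → Matrix (Fin n) κ ℂ, (∀ i : I, X i ∈ finiteCode (B i) (N i) ∧ X i ≠ 0) ∧
    d = √(stack X * (stack X).conjTranspose).det.re}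

/-- The decay function `D_I((N_i)_{i ∈ I})`, the minimum of `decaySet B I N`
(see `isLeast_decay`). -/
def decay {U r n : ℕ} {κ : Type} [Fintype κ] (B : Fin U → Fin r → Matrix (Fin n) κ ℂ)
    (I : Finset (Fin U)) (N : I → ℝ) : ℝ :=
  sInf (decaySet B I N)

theorem finiteCode_finite {r n : ℕ} {κ : Type} (B : Fin r → Matrix (Fin n) κ ℂ) (N : ℝ) :
    (finiteCode B N).Finite := by
  have h : (Set.pi Set.univ fun _ : Fin r => Set.Icc (-⌊N⌋) ⌊N⌋).Finite :=
    Set.Finite.pi fun _ => Set.finite_Icc _ _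
  refine (h.image fun c => ∑ i, c i • B i).subset ?_
  rintro X ⟨c, hc, rfl⟩
  refine ⟨c, fun i _ => ⟨?_, Int.le_floor.2 (hc i).2⟩, rfl⟩
  have : -(c i) ≤ ⌊N⌋ := Int.le_floor.2 (by push_cast; linarith [(hc i).1])
  linarith

/-- The infimum in the definition of the decay function is a minimum, as soon as every `N_i` is
at least `1` and every basis contains a nonzero matrix. -/
theorem isLeast_decay {U r n : ℕ} {κ : Type} [Fintype κ]
    (B : Fin U → Fin r → Matrix (Fin n) κ ℂ) (I : Finset (Fin U)) (N : I → ℝ)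
    (hN : ∀ i, 1 ≤ N i) (hB : ∀ i : I, ∃ s, B i s ≠ 0) :
    IsLeast (decaySet B I N) (decay B I N) := by
  have hfin : (decaySet B I N).Finite := by
    have h : (Set.pi Set.univ fun i : I => finiteCode (B i) (N i)).Finite :=
      Set.Finite.pi fun i => finiteCode_finite _ _
    refine (h.image fun X => √(stack X * (stack X).conjTranspose).det.re).subset ?_
    rintro d ⟨X, hX, rfl⟩
    exact ⟨X, fun i _ => (hX i).1, rfl⟩
  choose s hs using hB
  refine ⟨Set.Nonempty.csInf_mem ⟨_, fun i => B i (s i), fun i => ⟨?_, hs i⟩, rfl⟩ hfin,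
    fun d hd => csInf_le hfin.bddBelow hd⟩
  refine ⟨Pi.single (s i) 1, fun t => ?_, ?_⟩
  · have := hN i
    by_cases h : t = s i
    · subst h; simp; constructor <;> linarith
    · simp [Pi.single_eq_of_ne h]; linarith
  · rw [Finset.sum_eq_single (s i)]
    · simp
    · intro t _ h; simp [Pi.single_eq_of_ne h]
    · simp

/-! ### The construction -/

/-- `L/K`, `σ`, `p` are suitable for `U` users with `n` antennas each: `K ⊆ ℂ` is imaginary
quadratic with class number one, `L = K(α)` with `α` real is a cyclic Galois extension of `K` of
degree `U n`, `σ` generates its Galois group, and `p` is a prime of `𝒪_K` that is inert in `L`. -/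
structure IsSuitable (U n : ℕ) (K : IntermediateField ℚ ℂ) [NumberField K]
    (L : IntermediateField K ℂ) (σ : L ≃ₐ[K] L) (p : 𝓞 K) : Prop where
  quadratic : Module.finrank ℚ K = 2
  imaginary : ∃ z ∈ K, z.im ≠ 0
  classNumber_eq_one : NumberField.classNumber K = 1
  isGalois : IsGalois K L
  degree : Module.finrank K L = U * n
  real_generator : ∃ α : ℝ, L = IntermediateField.adjoin K {(α : ℂ)}
  generates : ∀ g : L ≃ₐ[K] L, g ∈ Subgroup.zpowers σ
  prime : Prime p
  inert : Prime (algebraMap (𝓞 K) (𝓞 L) p)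

section Construction

variable {K : IntermediateField ℚ ℂ} {L : IntermediateField K ℂ}

/-- The matrix `M(x₁, …, xₙ)` of the left regular representation of the cyclic algebra
`(L/F, τ, p)`. With indices starting from `0`, its entry in row `i` and column `j` is
`τ^j(x_{i-j})` if `j ≤ i`, and `p τ^j(x_{n+i-j})` if `i < j`; the subtraction in `Fin n` is
modulo `n`. -/
def cyclicMatrix {n : ℕ} (τ : L ≃ₐ[K] L) (p : 𝓞 K) (x : Fin n → 𝓞 L) :
    Matrix (Fin n) (Fin n) L :=
  Matrix.of fun i j =>
    (if i < j then algebraMap K L (p : K) else 1) * (τ ^ (j : ℕ)) ((x (i - j) : 𝓞 L) : L)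

/-- The codeword `(M, σ(M), …, p^{-m} σ^j(M), …, σ^{U-1}(M))` of user `j` (users and blocks are
numbered from `0`), where `M = M(x₁, …, xₙ)` is formed with `τ = σ^U`. The columns are indexed by
the pairs (block, column in the block). -/
def codeword {U n : ℕ} (σ : L ≃ₐ[K] L) (p : 𝓞 K) (m : ℤ) (j : Fin U) (x : Fin n → 𝓞 L) :
    Matrix (Fin n) (Fin U × Fin n) ℂ :=
  Matrix.of fun a c =>
    (((if c.1 = j then (algebraMap K L (p : K)) ^ (-m) else 1) *
      (σ ^ (c.1 : ℕ)) (cyclicMatrix (σ ^ U) p x a c.2) : L) : ℂ)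

theorem codeword_add {U n : ℕ} (σ : L ≃ₐ[K] L) (p : 𝓞 K) (m : ℤ) (j : Fin U)
    (x y : Fin n → 𝓞 L) :
    codeword σ p m j (x + y) = codeword σ p m j x + codeword σ p m j y := by
  ext a c
  simp only [codeword, cyclicMatrix, Matrix.of_apply, Matrix.add_apply, Pi.add_apply,
    map_add, mul_add, IntermediateField.coe_add]

/-- The lattice `𝐋_j` of user `j`: all codewords with `x₁, …, xₙ ∈ 𝒪_L`. -/
def userLattice (U n : ℕ) (σ : L ≃ₐ[K] L) (p : 𝓞 K) (m : ℤ) (j : Fin U) :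
    Submodule ℤ (Matrix (Fin n) (Fin U × Fin n) ℂ) where
  carrier := Set.range (codeword σ p m j)
  add_mem' := by
    rintro _ _ ⟨x, rfl⟩ ⟨y, rfl⟩
    exact ⟨x + y, codeword_add σ p m j x y⟩
  zero_mem' := ⟨0, map_zero (AddMonoidHom.mk' _ (codeword_add σ p m j))⟩
  smul_mem' := by
    rintro k _ ⟨x, rfl⟩
    exact ⟨k • x, map_zsmul (AddMonoidHom.mk' _ (codeword_add σ p m j)) k x⟩

end Construction

end MacCode

end

/-! `norm_det_submatrix_sq_le` bounds det(XX†) below by the squared modulus of any maximal minor;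
take the minor formed by the block columns of the users in `I`. Multiplying each of its rows by p^m
turns it into the image of some d ∈ 𝒪_L (`minorMatrix`): the diagonal blocks become integral and the
others carry p^m. A permutation that leaves the diagonal blocks does so at least twice, so modulo
p^(2m) d is the product of conjugates of the determinants of the M(x_i). Once common powers of p are
removed from each x_i, each of these has p-adic valuation at most n-1
(`emultiplicity_det_regularMatrix_lt`). Since 2m > U(n-1), d ≠ 0 (`det_minorMatrix_ne_zero`).

Moreover σ^U fixes d (`pow_apply_det_minorMatrix`), so the product of the σ^k(d), k < U, is a
nonzero element of 𝒪_K and has modulus at least 1 (`one_le_prod_norm`). The U-1 factors with k > 0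
are O((∏ N_i)^n), which bounds |d| below. For a single user, some conjugate of det M has modulus at
least 1, and the minor in that block column gives a bound independent of N. -/

namespace MacCode

/-! ### Gram determinants and maximal minors. -/

open Matrix ComplexOrder in
theorem one_le_re_det_one_add_mul_conjTranspose {ι κ : Type*} [Fintype ι] [DecidableEq ι]
    [Fintype κ] (W : Matrix ι κ ℂ) : 1 ≤ (1 + W * Wᴴ).det.re := by
  have hA := posSemidef_self_mul_conjTranspose W
  have hH : (1 + W * Wᴴ).IsHermitian := isHermitian_one.add hA.isHermitian
  have hdet : (1 + W * Wᴴ).det = ((∏ i, hH.eigenvalues i : ℝ) : ℂ) := by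
    rw [hH.det_eq_prod_eigenvalues, Complex.ofReal_prod]
    rfl
  rw [hdet, Complex.ofReal_re]
  refine Finset.one_le_prod fun i => ?_
  -- Each eigenvalue is the Rayleigh quotient of a unit eigenvector v, namely 1 + v†(WW†)v.
  rw [hH.eigenvalues_eq, add_mulVec, dotProduct_add, one_mulVec]
  have h1 : star (hH.eigenvectorBasis i).ofLp ⬝ᵥ (hH.eigenvectorBasis i).ofLp = 1 := by
    rw [dotProduct_comm, ← EuclideanSpace.inner_eq_star_dotProduct]
    simp
  rw [h1, map_add]
  have := (Complex.le_def.1 (hA.dotProduct_mulVec_nonneg (hH.eigenvectorBasis i).ofLp)).1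
  simpa using this

-- A substitute for keeping one term of Cauchy–Binet. Let Z be X with the columns of the minor Y set
-- to zero. Then XX† = YY† + ZZ†, and an invertible Y factors out, leaving 1 + WW† with W = Y⁻¹Z.
open Matrix ComplexOrder in
theorem norm_det_submatrix_sq_le {ι κ : Type*} [Fintype ι] [DecidableEq ι] [Fintype κ]
    (X : Matrix ι κ ℂ) {e : ι → κ} (he : Function.Injective e) :
    ‖(X.submatrix id e).det‖ ^ 2 ≤ (X * Xᴴ).det.re := by
  classical
  set Y := X.submatrix id e with hY
  by_cases h0 : Y.det = 0
  · rw [h0]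
    simpa using (Complex.le_def.1 (posSemidef_self_mul_conjTranspose X).det_nonneg).1
  let Z : Matrix ι κ ℂ := of fun i c => if c ∈ Set.range e then 0 else X i c
  have hsum : X * Xᴴ = Y * Yᴴ + Z * Zᴴ := by
    ext i j
    simp only [mul_apply, Matrix.add_apply, conjTranspose_apply]
    rw [← Finset.sum_add_sum_compl (Finset.univ.image e)]
    congr 1
    · rw [Finset.sum_image fun a _ b _ h => he h]
      rfl
    · have hz : ∑ c ∈ Finset.univ.image e, Z i c * star (Z j c) = 0 := by
        refine Finset.sum_eq_zero fun c hc => ?_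
        have : c ∈ Set.range e := by simpa using hc
        simp only [Z, of_apply, if_pos this, zero_mul]
      rw [← Finset.sum_add_sum_compl (Finset.univ.image e) (fun c => Z i c * star (Z j c)),
        hz, zero_add]
      refine Finset.sum_congr rfl fun c hc => ?_
      have : c ∉ Set.range e := by simpa using hc
      simp only [Z, of_apply, if_neg this]
  have hu : IsUnit Y.det := isUnit_iff_ne_zero.2 h0
  have hfac : X * Xᴴ = Y * (1 + (Y⁻¹ * Z) * (Y⁻¹ * Z)ᴴ) * Yᴴ := by
    have h1 : Y * (Y⁻¹ * Z) = Z := mul_nonsing_inv_cancel_left _ _ hu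
    calc X * Xᴴ = Y * Yᴴ + (Y * (Y⁻¹ * Z)) * (Y * (Y⁻¹ * Z))ᴴ := by rw [h1, hsum]
      _ = _ := by
        rw [conjTranspose_mul Y]
        simp only [Matrix.mul_add, Matrix.add_mul, Matrix.mul_one, Matrix.mul_assoc]
  have hdet : (X * Xᴴ).det
      = ((‖Y.det‖ ^ 2 : ℝ) : ℂ) * (1 + (Y⁻¹ * Z) * (Y⁻¹ * Z)ᴴ).det := by
    have h3 : Y.det * star Y.det = ((‖Y.det‖ ^ 2 : ℝ) : ℂ) := by
      rw [Complex.star_def, Complex.mul_conj, Complex.normSq_eq_norm_sq]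
    rw [hfac, det_mul, det_mul, det_conjTranspose, ← h3]
    ring
  rw [hdet, Complex.re_ofReal_mul]
  exact le_mul_of_one_le_right (by positivity) (one_le_re_det_one_add_mul_conjTranspose _)

/-! ### The q-adic valuation of the determinant of the regular representation. -/

section Ring

variable {R : Type*} [CommRing R]

/-- The matrix of the left regular representation of a cyclic algebra, over a general ring. -/
def regularMatrix {n : ℕ} (t : RingAut R) (q : R) (x : Fin n → R) : Matrix (Fin n) (Fin n) R :=
  Matrix.of fun i j => (if i < j then q else 1) * (t ^ (j : ℕ)) (x (i - j))

theorem pow_apply_eq_self {s : RingAut R} {q : R} (hs : s q = q) (k : ℕ) : (s ^ k) q = q := by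
  induction k with
  | zero => rfl
  | succ k ih => rw [pow_succ, RingAut.mul_apply, hs, ih]

theorem dvd_aut_apply_iff {g : RingAut R} {q : R} (hg : g q = q) {x : R} :
    q ∣ g x ↔ q ∣ x := by
  conv_lhs => rw [← hg]
  exact map_dvd_iff g

theorem emultiplicity_aut_apply {g : RingAut R} {q : R} (hg : g q = q) (x : R) :
    emultiplicity q (g x) = emultiplicity q x := by
  conv_lhs => rw [← hg]
  exact emultiplicity_map_eq g

/-- This is x = u·y in the cyclic algebra with generator u, uⁿ = q: left multiplication by u rotates
the rows and puts q on the row that wraps around. -/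
theorem regularMatrix_shift {k : ℕ} (t : RingAut R) {q : R} (ht : t q = q)
    {x y : Fin (k + 1) → R} (h0 : x 0 = q * y (0 - 1)) (h : ∀ i, i ≠ 0 → x i = y (i - 1))
    (i j : Fin (k + 1)) :
    regularMatrix t q x i j = (if i = 0 then q else 1) * regularMatrix t q y (i - 1) j := by
  have hsub : i - 1 - j = i - j - 1 := by abel
  simp only [regularMatrix, Matrix.of_apply, hsub]
  by_cases hij : i = j
  · subst hij
    rw [sub_self, h0, map_mul, pow_apply_eq_self ht]
    by_cases hi : i = 0
    · subst hi
      simp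
    · have : i - 1 < i := by
        rw [Fin.lt_def, Fin.val_sub_one_of_ne_zero hi]
        have := Fin.val_ne_zero_iff.2 hi
        omega
      simp [hi, this]
  · rw [h _ (sub_ne_zero.2 hij)]
    by_cases hi : i = 0
    · subst hi
      have h1 : (0 : Fin (k + 1)) < j := Fin.pos_iff_ne_zero.2 fun h => hij h.symm
      have h2 : ¬ ((0 : Fin (k + 1)) - 1 < j) := by
        rw [zero_sub, not_lt, Fin.le_def, Fin.coe_neg_one]
        exact Nat.lt_succ_iff.1 j.isLt
      rw [if_pos h1, if_neg h2]
      simp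
    · have : i - 1 < j ↔ i < j := by
        rw [Fin.lt_def, Fin.lt_def, Fin.val_sub_one_of_ne_zero hi]
        have := Fin.val_ne_zero_iff.2 hi
        have := Fin.val_ne_iff.2 hij
        omega
      simp [hi, this]

theorem associated_det_regularMatrix_shift {k : ℕ} (t : RingAut R) {q : R} (ht : t q = q)
    {x y : Fin (k + 1) → R} (h0 : x 0 = q * y (0 - 1)) (h : ∀ i, i ≠ 0 → x i = y (i - 1)) :
    Associated (regularMatrix t q x).det (q * (regularMatrix t q y).det) := by
  have hM : regularMatrix t q x = Matrix.of fun i j => (if i = 0 then q else 1) *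
      (regularMatrix t q y).submatrix (Equiv.subRight (1 : Fin (k + 1))) id i j := by
    ext i j
    exact regularMatrix_shift t ht h0 h i j
  rw [hM, Matrix.det_mul_column, Matrix.det_permute, Finset.prod_ite_eq' Finset.univ (0 : Fin (k+1))
    (fun _ => q), if_pos (Finset.mem_univ _)]
  refine Associated.mul_left q ?_
  obtain hs | hs := Int.units_eq_one_or (Equiv.Perm.sign (Equiv.subRight (1 : Fin (k + 1)))) <;>
    rw [hs]
  · simp
  · simp

/-- Conjugating by the generator of the cyclic algebra applies `t` to the coefficients. -/
theorem regularMatrix_conj {k : ℕ} (t : RingAut R) (ht : t ^ (k + 1) = 1) {q : R} (hq : t q = q)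
    (x : Fin (k + 1) → R) (i j : Fin (k + 1)) :
    (if j = Fin.last k then q else 1) * regularMatrix t q x (i + 1) (j + 1) =
      (if i = Fin.last k then q else 1) * t (regularMatrix t q x i j) := by
  have hsub : i + 1 - (j + 1) = i - j := by abel
  -- At the last index `j + 1` wraps to `0`, and `ht` supplies the missing power of `t`.
  have hpow : (if j = Fin.last k then q else 1) * (t ^ ((j + 1 : Fin (k + 1)) : ℕ)) (x (i - j)) =
      (if j = Fin.last k then q else 1) * t ((t ^ (j : ℕ)) (x (i - j))) := by
    congr 1
    rw [← RingAut.mul_apply, ← pow_succ']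
    congr 1
    by_cases hj : j = Fin.last k
    · subst hj
      simp [ht]
    · rw [Fin.val_add_one_of_lt (Fin.lt_last_iff_ne_last.2 hj)]
  simp only [regularMatrix, Matrix.of_apply, hsub, map_mul, apply_ite t, hq, map_one]
  rw [mul_left_comm, hpow]
  rw [← mul_assoc, ← mul_assoc]
  congr 1
  by_cases hi : i = Fin.last k <;> by_cases hj : j = Fin.last k
  · simp [hi, hj]
  · have h1 : (0 : Fin (k + 1)) < j + 1 := by
      rw [Fin.lt_def, Fin.val_add_one_of_lt (Fin.lt_last_iff_ne_last.2 hj)]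
      simp
    have h2 : ¬ Fin.last k < j := not_lt.2 (Fin.le_last j)
    simp [hi, hj, h1, h2]
  · have h2 : i < Fin.last k := Fin.lt_last_iff_ne_last.2 hi
    simp [hi, hj, h2]
  · have : i + 1 < j + 1 ↔ i < j := by
      rw [Fin.lt_def, Fin.lt_def, Fin.val_add_one_of_lt (Fin.lt_last_iff_ne_last.2 hi),
        Fin.val_add_one_of_lt (Fin.lt_last_iff_ne_last.2 hj)]
      omega
    simp [hi, hj, this]

/-- Modulo q the matrix is lower triangular with diagonal entries t^i(x 0), all nonzero in the
domain R/(q). -/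
theorem not_dvd_det_regularMatrix_zero {k : ℕ} (t : RingAut R) {q : R}
    (hq : Prime q) (ht : t q = q) {x : Fin (k + 1) → R} (hx : ¬ q ∣ x 0) :
    ¬ q ∣ (regularMatrix t q x).det := by
  have hI : (Ideal.span {q}).IsPrime := (Ideal.span_singleton_prime hq.ne_zero).2 hq
  set f := Ideal.Quotient.mk (Ideal.span {q}) with hf
  have hf0 : ∀ a, f a = 0 ↔ q ∣ a := fun a => by
    rw [hf, Ideal.Quotient.eq_zero_iff_mem, Ideal.mem_span_singleton]
  have hlow : (f.mapMatrix (regularMatrix t q x)).IsLowerTriangular := by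
    intro i j hij
    have hij' : i < j := hij
    simp [regularMatrix, hij', (hf0 q).2 dvd_rfl]
  rw [← hf0, RingHom.map_det, Matrix.det_of_isLowerTriangular _ hlow, Finset.prod_eq_zero_iff]
  rintro ⟨i, -, hi⟩
  have : f ((t ^ (i : ℕ)) (x 0)) = 0 := by simpa [regularMatrix] using hi
  exact hx ((dvd_aut_apply_iff (pow_apply_eq_self ht _)).1 ((hf0 _).1 this))

/-- Here `l` is the index of the first coefficient not divisible by q. If `l > 0`, then x = u·y
where y has first such index `l - 1`, and the determinant loses exactly one factor q. -/
theorem not_dvd_det_regularMatrix_of_first [IsDomain R] {k : ℕ} (t : RingAut R) {q : R}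
    (hq : Prime q) (ht : t q = q) (l : ℕ) :
    ∀ (x : Fin (k + 1) → R) (hl : l < k + 1), (∀ i : Fin (k + 1), (i : ℕ) < l → q ∣ x i) →
      ¬ q ∣ x ⟨l, hl⟩ → ¬ q ^ (l + 1) ∣ (regularMatrix t q x).det := by
  induction l with
  | zero =>
    intro x hl _ hx
    rw [zero_add, pow_one]
    exact not_dvd_det_regularMatrix_zero t hq ht hx
  | succ l ih =>
    intro x hl hdvd hx hdet
    obtain ⟨z, hz⟩ := hdvd 0 (by simp)
    -- y = u⁻¹x; `0 - 1` is the last index, where dividing by uⁿ = q is needed.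
    let y : Fin (k + 1) → R := fun i => if i = 0 - 1 then z else x (i + 1)
    have h0 : x 0 = q * y (0 - 1) := by simp [y, hz]
    have h : ∀ i, i ≠ 0 → x i = y (i - 1) := by
      intro i hi
      have : i - 1 ≠ 0 - 1 := fun h => hi (sub_left_injective h)
      simp only [y, if_neg this, sub_add_cancel]
    have key : ∀ i : Fin (k + 1), ∀ h' : (i : ℕ) + 1 < k + 1, y i = x ⟨i + 1, h'⟩ := by
      intro i h'
      have hlt : i < Fin.last k := by
        rw [Fin.lt_def, Fin.val_last]
        omega
      have hv := Fin.val_add_one_of_lt hlt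
      have h1 : i + 1 = ⟨i + 1, h'⟩ := Fin.ext hv
      have h2 : i + 1 ≠ 0 := by
        rw [h1]
        exact Fin.ne_of_val_ne (Nat.succ_ne_zero _)
      rw [← h1, h _ h2, add_sub_cancel_right]
    refine ih y (by omega) (fun i hi => ?_) ?_ ?_
    · rw [key i (by omega)]
      exact hdvd _ (by simpa using hi)
    · rw [key ⟨l, by omega⟩ hl]
      exact hx
    · rw [(associated_det_regularMatrix_shift t ht h0 h).dvd_iff_dvd_right, pow_succ'] at hdet
      exact (mul_dvd_mul_iff_left hq.ne_zero).1 hdet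

theorem emultiplicity_det_regularMatrix_lt [IsDomain R] {n : ℕ} (t : RingAut R) {q : R}
    (hq : Prime q) (ht : t q = q) {x : Fin n → R} (hx : ∃ i, ¬ q ∣ x i) :
    emultiplicity q (regularMatrix t q x).det < n := by
  classical
  obtain ⟨i, hi⟩ := hx
  obtain _ | k := n
  · exact i.elim0
  have hex : ∃ l : ℕ, ∃ hl : l < k + 1, ¬ q ∣ x ⟨l, hl⟩ := ⟨i, i.isLt, hi⟩
  obtain ⟨hl, hnd⟩ := Nat.find_spec hex
  have := not_dvd_det_regularMatrix_of_first t hq ht (Nat.find hex) x hl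
    (fun j hj => by
      by_contra hc
      exact Nat.find_min hex hj ⟨j.isLt, hc⟩) hnd
  refine lt_of_lt_of_le (emultiplicity_lt_iff_not_dvd.2 this) ?_
  exact_mod_cast hl

end Ring

/-! ### Nonvanishing of the minor and its invariance under σ^U. -/

section Ring

variable {R : Type*} [CommRing R]

/-- A permutation that moves exactly one index to another block does not exist, so that the
determinant of a matrix agrees with that of its block diagonal up to products of two entries
outside of the diagonal blocks. -/
theorem sq_dvd_det_sub_det {ι : Type*} [Fintype ι] [DecidableEq ι] (w : ι → ℤ) (q : R)
    {A D : Matrix ι ι R} (h₁ : ∀ i j, w i = w j → A i j = D i j)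
    (h₂ : ∀ i j, w i ≠ w j → q ∣ A i j ∧ D i j = 0) : q ^ 2 ∣ A.det - D.det := by
  rw [Matrix.det_apply, Matrix.det_apply, ← Finset.sum_sub_distrib]
  refine Finset.dvd_sum fun g _ => ?_
  rw [← smul_sub]
  refine dvd_smul_of_dvd _ ?_
  by_cases hg : ∀ i, w (g i) = w i
  · rw [Finset.prod_congr rfl fun i _ => h₁ _ _ (hg i), sub_self]
    exact dvd_zero _
  push Not at hg
  obtain ⟨a, ha⟩ := hg
  have hb : ∃ b, b ≠ a ∧ w (g b) ≠ w b := by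
    by_contra! hc
    -- Labels are integers so that displacements can be added: they sum to zero, so exactly one of
    -- them cannot be nonzero.
    have hsum : ∑ i, (w (g i) - w i) = 0 := by
      rw [Finset.sum_sub_distrib, Equiv.sum_comp g w, sub_self]
    rw [Finset.sum_eq_single a (fun b _ hb => by rw [hc b hb, sub_self]) (by simp)] at hsum
    exact ha (sub_eq_zero.1 hsum)
  obtain ⟨b, hba, hb⟩ := hb
  rw [Finset.prod_eq_zero (f := fun i => D (g i) i) (Finset.mem_univ a) (h₂ _ _ ha).2, sub_zero,
    ← Finset.mul_prod_erase _ _ (Finset.mem_univ a),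
    ← Finset.mul_prod_erase _ _ (Finset.mem_erase.2 ⟨hba, Finset.mem_univ b⟩), ← mul_assoc, sq]
  exact Dvd.dvd.mul_right (mul_dvd_mul (h₂ _ _ ha).1 (h₂ _ _ hb).1) _

/-- The square matrix formed by the block columns `w a`, `a ∈ ι`, of the stacked codewords,
multiplied by `q ^ m`. -/
def minorMatrix {ι : Type*} [DecidableEq ι] {n : ℕ} (w : ι → ℕ) (s : RingAut R) (U : ℕ) (q : R)
    (m : ℕ) (x : ι → Fin n → R) : Matrix (ι × Fin n) (ι × Fin n) R :=
  Matrix.of fun a c => (if c.1 = a.1 then 1 else q ^ m) *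
    (s ^ w c.1) (regularMatrix (s ^ U) q (x a.1) a.2 c.2)

variable {ι : Type*} [Fintype ι] [DecidableEq ι] {n : ℕ}

theorem sq_dvd_det_minorMatrix_sub (w : ι → ℕ) (s : RingAut R) (U : ℕ)
    (q : R) (m : ℕ) (x : ι → Fin n → R) :
    q ^ (2 * m) ∣ (minorMatrix w s U q m x).det -
      ∏ a, (s ^ w a) (regularMatrix (s ^ U) q (x a)).det := by
  have hD : ∏ a, (s ^ w a) (regularMatrix (s ^ U) q (x a)).det =
      ((Matrix.blockDiagonal fun a =>
        (regularMatrix (s ^ U) q (x a)).map (s ^ w a)).submatrix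
          (Equiv.prodComm ι (Fin n)) (Equiv.prodComm ι (Fin n))).det := by
    rw [Matrix.det_submatrix_equiv_self, Matrix.det_blockDiagonal]
    exact Finset.prod_congr rfl fun a _ => RingEquiv.map_det _ _
  rw [hD, mul_comm 2 m, pow_mul]
  refine sq_dvd_det_sub_det (fun a => ((Fintype.equivFin ι a.1 : ℕ) : ℤ)) (q ^ m) ?_ ?_
  · rintro ⟨a, i⟩ ⟨b, j⟩ h
    obtain rfl : a = b := by simpa [Fin.val_inj] using h
    simp [minorMatrix, Matrix.blockDiagonal_apply]
  · rintro ⟨a, i⟩ ⟨b, j⟩ h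
    have hab : a ≠ b := by rintro rfl; exact h rfl
    simp [minorMatrix, Matrix.blockDiagonal_apply, hab, hab.symm]

/-- Since s fixes q, a common power of q in `x a` pulls out of all rows of block a. This reduces
nonvanishing to the case where no `x a` is divisible by q. -/
theorem det_minorMatrix_smul (w : ι → ℕ) {s : RingAut R} {U : ℕ} {q : R} (hs : s q = q) (m : ℕ)
    (k : ι → ℕ) (x : ι → Fin n → R) :
    (minorMatrix w s U q m fun a i => q ^ k a * x a i).det =
      (∏ a : ι × Fin n, q ^ k a.1) * (minorMatrix w s U q m x).det := by
  rw [← Matrix.det_mul_column]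
  congr 1
  ext a c
  simp only [minorMatrix, regularMatrix, Matrix.of_apply, map_mul, map_pow, pow_apply_eq_self hs,
    ← pow_mul]
  ring

/-- Were it zero, q^(2m) would divide the product of the block determinants, whose valuation is at
most (n-1) per block. -/
theorem det_minorMatrix_ne_zero_of_not_dvd [IsDomain R] (w : ι → ℕ) {s : RingAut R} (U : ℕ)
    {q : R} (hq : Prime q) (hs : s q = q) {m : ℕ} (hm : Fintype.card ι * (n - 1) < 2 * m)
    {x : ι → Fin n → R} (hx : ∀ a, ∃ i, ¬ q ∣ x a i) :
    (minorMatrix w s U q m x).det ≠ 0 := by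
  intro h0
  have h := sq_dvd_det_minorMatrix_sub w s U q m x
  rw [h0, zero_sub, dvd_neg] at h
  have h1 := le_emultiplicity_of_pow_dvd h
  rw [Finset.emultiplicity_prod hq] at h1
  have h2 : ∀ a ∈ Finset.univ, emultiplicity q ((s ^ w a) (regularMatrix (s ^ U) q (x a)).det)
      ≤ ((n - 1 : ℕ) : ℕ∞) := by
    intro a _
    rw [emultiplicity_aut_apply (pow_apply_eq_self hs _)]
    have := emultiplicity_det_regularMatrix_lt (s ^ U) hq (pow_apply_eq_self hs _) (hx a)
    obtain _ | n := n
    · simp at this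
    · exact Order.le_of_lt_add_one (by exact_mod_cast this)
  have h3 := h1.trans (Finset.sum_le_card_nsmul _ _ _ h2)
  rw [nsmul_eq_mul, Finset.card_univ] at h3
  have : 2 * m ≤ Fintype.card ι * (n - 1) := by exact_mod_cast h3
  omega

theorem exists_eq_pow_mul_not_dvd [IsDomain R] [IsNoetherianRing R] {q : R} (hq : Prime q)
    {x : Fin n → R} (hx : x ≠ 0) :
    ∃ (k : ℕ) (y : Fin n → R), x = (fun i => q ^ k * y i) ∧ ∃ i, ¬ q ∣ y i := by
  classical
  have hex : ∃ k, ¬ ∀ i, q ^ (k + 1) ∣ x i := by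
    obtain ⟨i, hi⟩ := Function.ne_iff.1 hx
    obtain ⟨k, hk⟩ := FiniteMultiplicity.of_not_isUnit hq.not_isUnit hi
    exact ⟨k, fun h => hk (h i)⟩
  have hdvd : ∀ i, q ^ Nat.find hex ∣ x i := by
    rcases h : Nat.find hex with _ | l
    · simp
    · exact not_not.1 (Nat.find_min hex (h ▸ Nat.lt_succ_self l))
  choose y hy using hdvd
  refine ⟨Nat.find hex, y, funext hy, ?_⟩
  by_contra! hc
  refine Nat.find_spec hex fun i => ?_
  rw [hy i, pow_succ]
  exact mul_dvd_mul_left _ (hc i)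

theorem det_minorMatrix_ne_zero [IsDomain R] [IsNoetherianRing R] (w : ι → ℕ) {s : RingAut R}
    (U : ℕ) {q : R} (hq : Prime q) (hs : s q = q) {m : ℕ}
    (hm : Fintype.card ι * (n - 1) < 2 * m) {x : ι → Fin n → R} (hx : ∀ a, x a ≠ 0) :
    (minorMatrix w s U q m x).det ≠ 0 := by
  choose k y hxy hy using fun a => exists_eq_pow_mul_not_dvd hq (hx a)
  obtain rfl : x = fun a i => q ^ k a * y a i := funext hxy
  rw [det_minorMatrix_smul w hs]
  exact mul_ne_zero (Finset.prod_ne_zero_iff.2 fun a _ => pow_ne_zero _ hq.ne_zero)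
    (det_minorMatrix_ne_zero_of_not_dvd w U hq hs hm hy)

theorem det_minorMatrix_unit (s : RingAut R) (U : ℕ) (q : R) (m : ℕ) (x : Fin n → R) :
    (minorMatrix (fun _ : Unit => 0) s U q m fun _ => x).det = (regularMatrix (s ^ U) q x).det := by
  have e : minorMatrix (fun _ : Unit => 0) s U q m (fun _ => x) =
      (regularMatrix (s ^ U) q x).submatrix
        (Equiv.punitProd (Fin n)) (Equiv.punitProd (Fin n)) := by
    ext a c
    simp [minorMatrix]
  rw [e, Matrix.det_submatrix_equiv_self]

theorem det_regularMatrix_ne_zero [IsDomain R] [IsNoetherianRing R] {s : RingAut R} (U : ℕ)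
    {q : R} (hq : Prime q) (hs : s q = q) {x : Fin n → R} (hx : x ≠ 0) :
    (regularMatrix (s ^ U) q x).det ≠ 0 := by
  -- With one block the exponent plays no role; `n` satisfies n - 1 < 2n.
  rw [← det_minorMatrix_unit s U q n x]
  refine det_minorMatrix_ne_zero _ U hq hs ?_ fun _ => hx
  obtain ⟨i, -⟩ := Function.ne_iff.1 hx
  have := i.pos
  rw [Fintype.card_unit]
  omega

/-- Applying s^U entrywise amounts to conjugating every block by the generator of the algebra, that
is, by one monomial matrix made of the permutation `e` and the diagonal `v`. The identity is kept
free of inverses, and ∏ v is cancelled at the end. -/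
theorem pow_apply_det_minorMatrix [IsDomain R] (w : ι → ℕ) {s : RingAut R} {U : ℕ}
    (hsU : s ^ (U * n) = 1) {q : R} (hq : q ≠ 0) (hs : s q = q) (m : ℕ) (x : ι → Fin n → R) :
    (s ^ U) (minorMatrix w s U q m x).det = (minorMatrix w s U q m x).det := by
  obtain _ | k := n
  · simp
  set t := s ^ U with htdef
  have ht : t ^ (k + 1) = 1 := by rw [htdef, ← pow_mul, hsU]
  have htq : t q = q := pow_apply_eq_self hs U
  set Y := minorMatrix w s U q m x with hY
  let v : ι × Fin (k + 1) → R := fun a => if a.2 = Fin.last k then q else 1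
  let e : Equiv.Perm (ι × Fin (k + 1)) := (Equiv.refl ι).prodCongr (Equiv.addRight 1)
  have hconj : Matrix.of (fun a c => v c * Y.submatrix e e a c) =
      Matrix.of (fun a c => v a * Y.map t a c) := by
    ext a c
    have hc := congrArg (s ^ w c.1) (regularMatrix_conj t ht htq (x a.1) a.2 c.2)
    simp only [map_mul, apply_ite (s ^ w c.1 : RingAut R), pow_apply_eq_self hs, map_one] at hc
    have hcomm : ∀ z, t ((s ^ w c.1) z) = (s ^ w c.1) (t z) := fun z => by
      rw [← RingAut.mul_apply, ← RingAut.mul_apply, htdef, ← pow_add, ← pow_add, add_comm]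
    simp only [Matrix.of_apply, Matrix.submatrix_apply, Matrix.map_apply, hY, minorMatrix, v, e,
      Equiv.prodCongr_apply, Prod.map_fst, Prod.map_snd, Equiv.refl_apply, Equiv.coe_addRight,
      map_mul, apply_ite t, map_pow, htq, map_one, hcomm]
    rw [mul_left_comm, hc, mul_left_comm]
    rfl
  have hdet := congrArg Matrix.det hconj
  rw [Matrix.det_mul_row, Matrix.det_mul_column, Matrix.det_submatrix_equiv_self] at hdet
  have hv : ∏ a, v a ≠ 0 := Finset.prod_ne_zero_iff.2 fun a _ => by
    by_cases h : a.2 = Fin.last k <;> simp [v, h, hq]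
  exact (RingEquiv.map_det t Y).trans (mul_left_cancel₀ hv hdet).symm

end Ring

/-! ### Integers of K and L, and the relative norm. -/

/-- The two embeddings of K are the inclusion and its complex conjugate, so |z|² is the absolute
value of the norm of z, a nonzero rational integer. -/
theorem one_le_norm_of_quadratic {K : IntermediateField ℚ ℂ} [NumberField K]
    (h2 : Module.finrank ℚ K = 2) (him : ∃ z ∈ K, z.im ≠ 0) {z : 𝓞 K} (hz : z ≠ 0) :
    1 ≤ ‖((z : K) : ℂ)‖ := by
  classical
  obtain ⟨y, hyK, hy⟩ := him
  let v : K →ₐ[ℚ] ℂ := RingHom.toRatAlgHom (algebraMap K ℂ)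
  let c : K →ₐ[ℚ] ℂ := RingHom.toRatAlgHom ((starRingEnd ℂ).comp (algebraMap K ℂ))
  have hc : ∀ x : K, c x = (starRingEnd ℂ) (x : ℂ) := fun x => rfl
  have hne : v ≠ c := fun h => hy <| Complex.conj_eq_iff_im.1 <|
    (DFunLike.congr_fun h (⟨y, hyK⟩ : K)).symm
  have huniv : ({v, c} : Finset (K →ₐ[ℚ] ℂ)) = Finset.univ := by
    apply Finset.eq_univ_of_card
    rw [Finset.card_pair hne, AlgHom.card, h2]
  have hprod := Algebra.norm_eq_prod_embeddings ℚ ℂ (z : K)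
  rw [← huniv, Finset.prod_pair hne, hc] at hprod
  have hnorm : ‖((z : K) : ℂ)‖ ^ 2 = ((|Algebra.norm ℤ z| : ℤ) : ℝ) := by
    have h1 : (algebraMap ℚ ℂ) (Algebra.norm ℚ (z : K)) = ((Algebra.norm ℤ z : ℤ) : ℂ) := by
      rw [← Algebra.coe_norm_int]
      simp
    rw [h1] at hprod
    have h2 := congrArg norm hprod
    rw [norm_mul, RCLike.norm_conj, Complex.norm_intCast] at h2
    rw [sq, Int.cast_abs, h2]
    rfl
  have h1 : (1 : ℝ) ≤ ((|Algebra.norm ℤ z| : ℤ) : ℝ) := by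
    exact_mod_cast Int.one_le_abs (Algebra.norm_ne_zero_iff.2 hz)
  rw [← hnorm] at h1
  exact (one_le_sq_iff₀ (norm_nonneg _)).1 h1

section Integers

variable {K : IntermediateField ℚ ℂ} {L : IntermediateField K ℂ}

/-- The action of an automorphism of `L` on the ring of integers. -/
noncomputable def integerAut (σ : L ≃ₐ[K] L) : RingAut (𝓞 L) :=
  NumberField.RingOfIntegers.mapRingEquiv σ.toRingEquiv

theorem coe_integerAut_pow (σ : L ≃ₐ[K] L) (k : ℕ) (x : 𝓞 L) :
    (((integerAut σ ^ k) x : 𝓞 L) : L) = (σ ^ k) (x : L) := by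
  induction k with
  | zero => rfl
  | succ k ih =>
    rw [pow_succ', pow_succ', RingAut.mul_apply, AlgEquiv.mul_apply, ← ih]
    rfl

theorem coe_integerAut_pow_pow (σ : L ≃ₐ[K] L) (k l : ℕ) (x : 𝓞 L) :
    ((((integerAut σ ^ k) ^ l) x : 𝓞 L) : L) = ((σ ^ k) ^ l) (x : L) := by
  rw [← pow_mul, ← pow_mul, coe_integerAut_pow]

theorem integerAut_algebraMap (σ : L ≃ₐ[K] L) (p : 𝓞 K) :
    integerAut σ (algebraMap (𝓞 K) (𝓞 L) p) = algebraMap (𝓞 K) (𝓞 L) p :=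
  NumberField.RingOfIntegers.ext (σ.commutes (p : K))

theorem integerAut_pow_finrank [FiniteDimensional K L] [IsGalois K L] (σ : L ≃ₐ[K] L) :
    integerAut σ ^ Module.finrank K L = 1 := by
  ext x
  rw [coe_integerAut_pow, ← IsGalois.card_aut_eq_finrank, pow_card_eq_one']
  rfl

/-- The inclusion of the ring of integers of `L` in `ℂ`. -/
noncomputable def integerEmb : 𝓞 L →+* ℂ := (algebraMap L ℂ).comp (algebraMap (𝓞 L) L)

theorem integerEmb_apply (x : 𝓞 L) : integerEmb x = ((x : L) : ℂ) := rfl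

/-- A nonzero integer in the fixed field of `σ ^ U` has a relative norm of absolute value at
least one. -/
theorem one_le_prod_norm [NumberField K] (h2 : Module.finrank ℚ K = 2)
    (him : ∃ z ∈ K, z.im ≠ 0) [FiniteDimensional K L] [IsGalois K L] {σ : L ≃ₐ[K] L}
    (hσ : ∀ g : L ≃ₐ[K] L, g ∈ Subgroup.zpowers σ) {U : ℕ} {d : 𝓞 L} (hd : d ≠ 0)
    (hU : (integerAut σ ^ U) d = d) :
    1 ≤ ∏ k ∈ Finset.range U, ‖integerEmb ((integerAut σ ^ k) d)‖ := by
  set s := integerAut σ with hs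
  set e : 𝓞 L := ∏ k ∈ Finset.range U, (s ^ k) d with he
  have he0 : e ≠ 0 := Finset.prod_ne_zero_iff.2 fun k _ =>
    (map_ne_zero_iff _ (s ^ k).injective).2 hd
  have hse : s e = e := by
    rw [he, map_prod]
    -- Splitting the product over k < U + 1 at either end gives s(e)·d = e·s^U(d) = e·d.
    have h1 := Finset.prod_range_succ (fun k => (s ^ k) d) U
    rw [Finset.prod_range_succ', hU] at h1
    refine mul_right_cancel₀ hd ?_
    rw [← h1]
    congr 1
    exact Finset.prod_congr rfl fun k _ => by rw [pow_succ', RingAut.mul_apply]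
  have hσe : σ (e : L) = e := congrArg (algebraMap (𝓞 L) L) hse
  have hfix : ∀ g : L ≃ₐ[K] L, g (e : L) = e := by
    intro g
    have : Subgroup.zpowers σ ≤ MulAction.stabilizer (L ≃ₐ[K] L) (e : L) :=
      (Subgroup.zpowers_le).2 hσe
    exact this (hσ g)
  obtain ⟨y, hy⟩ := IntermediateField.mem_bot.1 ((IsGalois.mem_bot_iff_fixed (e : L)).2 hfix)
  have hint : IsIntegral ℤ y :=
    (isIntegral_algebraMap_iff (algebraMap K L).injective).1 (hy ▸ e.isIntegral_coe)
  have hy0 : (⟨y, hint⟩ : 𝓞 K) ≠ 0 := by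
    intro h
    have : y = 0 := congrArg (algebraMap (𝓞 K) K) h
    rw [this, map_zero] at hy
    exact he0 (NumberField.RingOfIntegers.ext hy.symm)
  have h1 := one_le_norm_of_quadratic h2 him hy0
  rw [← norm_prod, ← map_prod, ← he, integerEmb_apply, ← hy]
  exact h1

end Integers

/-! ### Upper bounds for conjugates. -/

theorem norm_det_le_factorial_mul_prod {ι : Type*} [Fintype ι] [DecidableEq ι]
    {A : Matrix ι ι ℂ} {b : ι → ℝ} (h : ∀ i j, ‖A i j‖ ≤ b i) :
    ‖A.det‖ ≤ (Fintype.card ι).factorial * ∏ i, b i := by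
  rw [Matrix.det_apply]
  refine (norm_sum_le_of_le (f := fun g : Equiv.Perm ι => Equiv.Perm.sign g • ∏ i, A (g i) i)
    Finset.univ (n := fun _ => ∏ i, b i) fun g _ => ?_).trans_eq ?_
  · have hs : ‖Equiv.Perm.sign g • ∏ i, A (g i) i‖ = ‖∏ i, A (g i) i‖ := by
      obtain hs | hs := Int.units_eq_one_or (Equiv.Perm.sign g) <;> rw [hs] <;> simp
    rw [hs, norm_prod, ← Equiv.prod_comp g b]
    exact Finset.prod_le_prod (fun _ _ => norm_nonneg _) fun i _ => h _ _
  · rw [Finset.sum_const, Finset.card_univ, Fintype.card_perm, nsmul_eq_mul]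

section Bounds

variable {K : IntermediateField ℚ ℂ} {L : IntermediateField K ℂ}

theorem integerEmb_algebraMap (p : 𝓞 K) :
    integerEmb (algebraMap (𝓞 K) (𝓞 L) p) = ((p : K) : ℂ) := rfl

theorem integerEmb_injective : Function.Injective (integerEmb (L := L)) :=
  (algebraMap L ℂ).injective.comp NumberField.RingOfIntegers.coe_injective

theorem codeword_apply {U n : ℕ} (σ : L ≃ₐ[K] L) (p : 𝓞 K) (m : ℤ) (j : Fin U)
    (x : Fin n → 𝓞 L) (a : Fin n) (c : Fin U × Fin n) :
    codeword σ p m j x a c = (if c.1 = j then ((p : K) : ℂ) ^ (-m) else 1) *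
      integerEmb ((integerAut σ ^ (c.1 : ℕ)) (regularMatrix (integerAut σ ^ U)
        (algebraMap (𝓞 K) (𝓞 L) p) x a c.2)) := by
  have hcyc : cyclicMatrix (σ ^ U) p x a c.2 = ((regularMatrix (integerAut σ ^ U)
      (algebraMap (𝓞 K) (𝓞 L) p) x a c.2 : 𝓞 L) : L) := by
    simp only [cyclicMatrix, regularMatrix, Matrix.of_apply, map_mul, coe_integerAut_pow_pow]
    congr 1
    split_ifs
    · rfl
    · rw [map_one]
  rw [integerEmb_apply, coe_integerAut_pow, ← hcyc]
  simp only [codeword, Matrix.of_apply, IntermediateField.coe_mul]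
  congr 1
  split_ifs
  · rw [← map_zpow₀]
    exact map_zpow₀ (algebraMap K ℂ) _ _
  · rfl

theorem norm_integerEmb_regularMatrix_le {n : ℕ} {σ : L ≃ₐ[K] L} (U : ℕ) {p : 𝓞 K}
    (hp : 1 ≤ ‖((p : K) : ℂ)‖) {x : Fin n → 𝓞 L} {T : ℝ}
    (hT : ∀ k l, ‖integerEmb ((integerAut σ ^ k) (x l))‖ ≤ T) (k : ℕ) (i j : Fin n) :
    ‖integerEmb ((integerAut σ ^ k) (regularMatrix (integerAut σ ^ U)
      (algebraMap (𝓞 K) (𝓞 L) p) x i j))‖ ≤ ‖((p : K) : ℂ)‖ * T := by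
  have hfix := pow_apply_eq_self (integerAut_algebraMap σ p) k
  simp only [regularMatrix, Matrix.of_apply, map_mul, apply_ite (integerAut σ ^ k : RingAut (𝓞 L)),
    hfix, map_one, norm_mul]
  rw [← pow_mul, ← RingAut.mul_apply, ← pow_add]
  refine mul_le_mul ?_ (hT _ _) (norm_nonneg _) (by positivity)
  split_ifs
  · rw [integerEmb_algebraMap]
  · simpa using hp

variable {ι : Type*} [Fintype ι] [DecidableEq ι] {n : ℕ}

/-- Leibniz expansion: an entry is at most |p|^(m+1) T, with |p|^m from the scaling of off-diagonal
blocks and one |p| from the regular representation. Each T i is counted once for each of the n rows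
of its block. -/
theorem norm_integerEmb_det_minorMatrix_le {σ : L ≃ₐ[K] L} (w : ι → ℕ) (U : ℕ) {p : 𝓞 K}
    (hp : 1 ≤ ‖((p : K) : ℂ)‖) (m : ℕ) {x : ι → Fin n → 𝓞 L} {T : ι → ℝ}
    (hT : ∀ i k l, ‖integerEmb ((integerAut σ ^ k) (x i l))‖ ≤ T i) (k : ℕ) :
    ‖integerEmb ((integerAut σ ^ k) (minorMatrix w (integerAut σ) U
      (algebraMap (𝓞 K) (𝓞 L) p) m x).det)‖ ≤
      (Fintype.card (ι × Fin n)).factorial *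
        ((‖((p : K) : ℂ)‖ ^ (m + 1)) ^ Fintype.card (ι × Fin n) * (∏ i, T i) ^ n) := by
  let f : 𝓞 L →+* ℂ := integerEmb.comp (integerAut σ ^ k : RingAut (𝓞 L)).toRingHom
  have hf : ∀ z, integerEmb ((integerAut σ ^ k) z) = f z := fun _ => rfl
  have hprod : (‖((p : K) : ℂ)‖ ^ (m + 1)) ^ Fintype.card (ι × Fin n) * (∏ i, T i) ^ n =
      ∏ a : ι × Fin n, ‖((p : K) : ℂ)‖ ^ (m + 1) * T a.1 := by
    rw [Finset.prod_mul_distrib, Finset.prod_const, Finset.card_univ, Fintype.prod_prod_type]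
    simp only [Finset.prod_const, Finset.card_univ, Fintype.card_fin, Finset.prod_pow]
  rw [hprod, hf, RingHom.map_det]
  refine norm_det_le_factorial_mul_prod fun a c => ?_
  have hfix := pow_apply_eq_self (integerAut_algebraMap σ p) k
  rw [RingHom.mapMatrix_apply, Matrix.map_apply, ← hf]
  simp only [minorMatrix, Matrix.of_apply, map_mul, norm_mul]
  rw [← RingAut.mul_apply, ← pow_add, pow_succ, mul_assoc]
  refine mul_le_mul ?_ (norm_integerEmb_regularMatrix_le U hp (hT a.1) _ _ _) (norm_nonneg _)
    (by positivity)
  split_ifs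
  · simpa using one_le_pow₀ hp
  · rw [map_pow, hfix, map_pow, integerEmb_algebraMap, norm_pow]

end Bounds

/-! ### Lower bounds for determinants of suitable codes. -/

section Suitable

variable {K : IntermediateField ℚ ℂ} [NumberField K] {L : IntermediateField K ℂ}
  {U n : ℕ} {σ : L ≃ₐ[K] L} {p : 𝓞 K}

theorem IsSuitable.finiteDimensional (h : IsSuitable U n K L σ p) (hU : 0 < U) (hn : 0 < n) :
    FiniteDimensional K L :=
  Module.finite_of_finrank_pos (h.degree ▸ Nat.mul_pos hU hn)

theorem IsSuitable.one_le_norm (h : IsSuitable U n K L σ p) : 1 ≤ ‖((p : K) : ℂ)‖ :=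
  one_le_norm_of_quadratic h.quadratic h.imaginary h.prime.ne_zero

theorem IsSuitable.pow_eq_one (h : IsSuitable U n K L σ p) (hU : 0 < U) (hn : 0 < n) :
    integerAut σ ^ (U * n) = 1 := by
  have := h.finiteDimensional hU hn
  have := h.isGalois
  rw [← h.degree]
  exact integerAut_pow_finrank σ

theorem IsSuitable.isNoetherianRing (h : IsSuitable U n K L σ p) (hU : 0 < U) (hn : 0 < n) :
    IsNoetherianRing (𝓞 L) := by
  have := h.finiteDimensional hU hn
  have := NumberField.of_module_finite K L
  infer_instance

theorem IsSuitable.one_le_norm_det_minorMatrix_mul (h : IsSuitable U n K L σ p) (hU : 0 < U)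
    (hn : 0 < n) {ι : Type*} [Fintype ι] [DecidableEq ι] (w : ι → ℕ) {m : ℕ}
    (hm : Fintype.card ι * (n - 1) < 2 * m) {x : ι → Fin n → 𝓞 L} (hx : ∀ i, x i ≠ 0) {T : ι → ℝ}
    (hT : ∀ i k l, ‖integerEmb ((integerAut σ ^ k) (x i l))‖ ≤ T i) :
    1 ≤ ‖integerEmb (minorMatrix w (integerAut σ) U (algebraMap (𝓞 K) (𝓞 L) p) m x).det‖ *
      ((Fintype.card (ι × Fin n)).factorial *
        ((‖((p : K) : ℂ)‖ ^ (m + 1)) ^ Fintype.card (ι × Fin n) * (∏ i, T i) ^ n)) ^ (U - 1) := by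
  have := h.finiteDimensional hU hn
  have := h.isNoetherianRing hU hn
  have := h.isGalois
  have hfix := integerAut_algebraMap σ p
  have h0 := det_minorMatrix_ne_zero w U h.inert hfix hm hx
  have h1 := one_le_prod_norm h.quadratic h.imaginary h.generates h0
    (pow_apply_det_minorMatrix w (h.pow_eq_one hU hn) h.inert.ne_zero hfix m x)
  obtain ⟨V, rfl⟩ := Nat.exists_eq_succ_of_ne_zero hU.ne'
  -- Only the factor k = 0 is kept; the other U - 1 are bounded above.
  rw [Finset.prod_range_succ', mul_comm] at h1
  refine h1.trans (mul_le_mul_of_nonneg_left ?_ (norm_nonneg _))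
  rw [Nat.succ_sub_one]
  refine (Finset.prod_le_prod (fun _ _ => norm_nonneg _) fun k _ =>
    norm_integerEmb_det_minorMatrix_le w _ h.one_le_norm m hT (k + 1)).trans_eq ?_
  rw [Finset.prod_const, Finset.card_range]

theorem IsSuitable.exists_one_le_norm_det_regularMatrix (h : IsSuitable U n K L σ p) (hU : 0 < U)
    (hn : 0 < n) {x : Fin n → 𝓞 L} (hx : x ≠ 0) :
    ∃ k < U, 1 ≤ ‖integerEmb ((integerAut σ ^ k) (regularMatrix (integerAut σ ^ U)
      (algebraMap (𝓞 K) (𝓞 L) p) x).det)‖ := by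
  have := h.finiteDimensional hU hn
  have := h.isNoetherianRing hU hn
  have := h.isGalois
  have hfix := integerAut_algebraMap σ p
  set d := (regularMatrix (integerAut σ ^ U) (algebraMap (𝓞 K) (𝓞 L) p) x).det with hd
  have h0 : d ≠ 0 := det_regularMatrix_ne_zero U h.inert hfix hx
  have hdU : (integerAut σ ^ U) d = d := by
    have := pow_apply_det_minorMatrix (fun _ : Unit => 0) (h.pow_eq_one hU hn) h.inert.ne_zero
      hfix 0 fun _ => x
    rwa [det_minorMatrix_unit] at this
  have h1 := one_le_prod_norm h.quadratic h.imaginary h.generates h0 hdU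
  by_contra! hc
  refine h1.not_gt ?_
  refine (Finset.prod_lt_prod_of_nonempty (g := fun _ => (1 : ℝ)) (fun k _ => ?_)
    (fun k hk => hc k (Finset.mem_range.1 hk)) ⟨0, Finset.mem_range.2 hU⟩).trans_eq (by simp)
  rw [norm_pos_iff]
  exact (map_ne_zero_iff _ integerEmb_injective).2
    ((map_ne_zero_iff _ (integerAut σ ^ k).injective).2 h0)

end Suitable

/-! ### Bounds for the decay function. -/

section Decay

theorem norm_det_minor_le_sqrt {U n : ℕ} {I : Finset (Fin U)}
    (X : I → Matrix (Fin n) (Fin U × Fin n) ℂ) {e : I × Fin n → Fin U × Fin n}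
    (he : Function.Injective e) :
    ‖((stack X).submatrix id e).det‖ ≤ √(stack X * (stack X).conjTranspose).det.re :=
  Real.le_sqrt_of_sq_le (norm_det_submatrix_sq_le _ he)

variable {K : IntermediateField ℚ ℂ} {L : IntermediateField K ℂ} {U n : ℕ} {σ : L ≃ₐ[K] L}
  {p : 𝓞 K}

theorem exists_codeword_of_mem_finiteCode {r : ℕ} {M : ℤ} {j : Fin U}
    {b : Fin r → Fin n → 𝓞 L} {A N : ℝ}
    (hA : ∀ s l k, ‖integerEmb ((integerAut σ ^ k) (b s l))‖ ≤ A) (hN : 0 ≤ N)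
    {X : Matrix (Fin n) (Fin U × Fin n) ℂ}
    (hX : X ∈ finiteCode (fun s => codeword σ p M j (b s)) N) (hX0 : X ≠ 0) :
    ∃ x : Fin n → 𝓞 L, X = codeword σ p M j x ∧ x ≠ 0 ∧
      ∀ k l, ‖integerEmb ((integerAut σ ^ k) (x l))‖ ≤ N * (r * A) := by
  obtain ⟨c, hc, rfl⟩ := hX
  let φ : (Fin n → 𝓞 L) →+ Matrix (Fin n) (Fin U × Fin n) ℂ :=
    AddMonoidHom.mk' (codeword σ p M j) (codeword_add σ p M j)
  have hφ : ∑ s, c s • codeword σ p M j (b s) = φ (∑ s, c s • b s) := by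
    rw [map_sum]
    exact Finset.sum_congr rfl fun s _ => (map_zsmul φ _ _).symm
  refine ⟨∑ s, c s • b s, hφ, ?_, fun k l => ?_⟩
  · intro h0
    rw [hφ, h0, map_zero] at hX0
    exact hX0 rfl
  · rw [Finset.sum_apply, map_sum, map_sum]
    refine (norm_sum_le_of_le Finset.univ (n := fun _ => N * A) fun s _ => ?_).trans_eq ?_
    · rw [Pi.smul_apply, map_zsmul, map_zsmul, zsmul_eq_mul, norm_mul, Complex.norm_intCast]
      exact mul_le_mul (abs_le.2 (hc s)) (hA s l k) (norm_nonneg _) hN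
    · rw [Finset.sum_const, Finset.card_univ, Fintype.card_fin, nsmul_eq_mul]
      ring

variable [NumberField K]

/-- The minor of the stacked codewords of the users in `I` formed by the block columns in `I`. -/
theorem IsSuitable.pow_mul_det_minor (h : IsSuitable U n K L σ p) (M : ℕ) (I : Finset (Fin U))
    (x : I → Fin n → 𝓞 L) :
    (((p : K) : ℂ) ^ M) ^ Fintype.card (I × Fin n) *
      ((stack fun i : I => codeword σ p M (i : Fin U) (x i)).submatrix id
        fun a : I × Fin n => ((a.1 : Fin U), a.2)).det =
    integerEmb (minorMatrix (fun i : I => (i : ℕ)) (integerAut σ) U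
      (algebraMap (𝓞 K) (𝓞 L) p) M x).det := by
  have hp0 : ((p : K) : ℂ) ≠ 0 := norm_pos_iff.1 (one_pos.trans_le h.one_le_norm)
  -- The scalar p^M cancels p^(-M) on the diagonal blocks and appears on all others.
  rw [← Matrix.det_smul, RingHom.map_det]
  congr 1
  ext a c
  rw [Matrix.smul_apply, Matrix.submatrix_apply, RingHom.mapMatrix_apply, Matrix.map_apply]
  simp only [stack, id, Matrix.of_apply, codeword_apply, minorMatrix, map_mul, smul_eq_mul]
  rw [← mul_assoc]
  congr 1
  by_cases hac : c.1 = a.1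
  · simp [hac, hp0]
  · have : (c.1 : Fin U) ≠ a.1 := fun h => hac (Subtype.ext h)
    simp [hac, this, integerEmb_algebraMap]

/-- The minor is taken in a block column k where the conjugate of det M has modulus at least 1. The
only possible loss is p^(-M) in each of n rows, when k is the user's own block. -/
theorem IsSuitable.sqrt_det_of_card_eq_one (h : IsSuitable U n K L σ p) (hU : 0 < U) (hn : 0 < n)
    (M : ℕ) {I : Finset (Fin U)} (hI : I.card = 1) {x : I → Fin n → 𝓞 L} (hx : ∀ i, x i ≠ 0) :
    (‖((p : K) : ℂ)‖ ^ (M * n))⁻¹ ≤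
      √(stack (fun i : I => codeword σ p M (i : Fin U) (x i)) *
        (stack fun i : I => codeword σ p M (i : Fin U) (x i)).conjTranspose).det.re := by
  obtain ⟨j, rfl⟩ := Finset.card_eq_one.1 hI
  let j' : ({j} : Finset (Fin U)) := ⟨j, Finset.mem_singleton_self j⟩
  have hj : ∀ i : ({j} : Finset (Fin U)), i = j' := fun i =>
    Subtype.ext (Finset.mem_singleton.1 i.2)
  have : Unique ({j} : Finset (Fin U)) := ⟨⟨j'⟩, hj⟩
  obtain ⟨k, hk, hle⟩ := h.exists_one_le_norm_det_regularMatrix hU hn (hx j')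
  let e : ({j} : Finset (Fin U)) × Fin n → Fin U × Fin n := fun a => (⟨k, hk⟩, a.2)
  have he : Function.Injective e := fun a b hab =>
    Prod.ext (Subsingleton.elim _ _) (congrArg (fun y : Fin U × Fin n => y.2) hab)
  refine le_trans ?_ (norm_det_minor_le_sqrt _ he)
  set c : ℂ := if (⟨k, hk⟩ : Fin U) = j then ((p : K) : ℂ) ^ (-(M : ℤ)) else 1 with hc
  let f : 𝓞 L →+* ℂ := integerEmb.comp (integerAut σ ^ k : RingAut (𝓞 L)).toRingHom
  have hf : ∀ z, integerEmb ((integerAut σ ^ k) z) = f z := fun _ => rfl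
  have hsub : (stack fun i : ({j} : Finset (Fin U)) =>
      codeword σ p M (i : Fin U) (x i)).submatrix id e =
      (c • f.mapMatrix (regularMatrix (integerAut σ ^ U) (algebraMap (𝓞 K) (𝓞 L) p)
        (x j'))).submatrix (Equiv.uniqueProd (Fin n) _) (Equiv.uniqueProd (Fin n) _) := by
    ext a b
    obtain ⟨a₁, a₂⟩ := a
    obtain rfl := hj a₁
    simp only [stack, Matrix.submatrix_apply, id, Matrix.of_apply, codeword_apply, e,
      Matrix.smul_apply, RingHom.mapMatrix_apply, Matrix.map_apply, smul_eq_mul, ← hf]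
    rfl
  rw [hsub, Matrix.det_submatrix_equiv_self, Matrix.det_smul, ← RingHom.map_det, ← hf, norm_mul,
    norm_pow, Fintype.card_fin, pow_mul, ← inv_pow]
  have hcle : (‖((p : K) : ℂ)‖ ^ M)⁻¹ ≤ ‖c‖ := by
    rw [hc]
    split_ifs
    · rw [zpow_neg, zpow_natCast, norm_inv, norm_pow]
    · rw [norm_one]
      exact inv_le_one_of_one_le₀ (one_le_pow₀ h.one_le_norm)
  calc ((‖((p : K) : ℂ)‖ ^ M)⁻¹) ^ n ≤ ‖c‖ ^ n := pow_le_pow_left₀ (by positivity) hcle n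
    _ ≤ _ := le_mul_of_one_le_right (by positivity) hle

/-- σ has finite order, so only finitely many conjugates occur. -/
theorem IsSuitable.exists_norm_bound (h : IsSuitable U n K L σ p) (hU : 0 < U) (hn : 0 < n)
    {κ : Type*} [Finite κ] (z : κ → 𝓞 L) :
    ∃ A : ℝ, 0 < A ∧ ∀ i k, ‖integerEmb ((integerAut σ ^ k) (z i))‖ ≤ A := by
  obtain ⟨A, hA⟩ := Finite.bddAbove_range fun a : κ × Fin (U * n) =>
    ‖integerEmb ((integerAut σ ^ (a.2 : ℕ)) (z a.1))‖
  refine ⟨max A 1, by positivity, fun i k => le_max_of_le_left ?_⟩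
  rw [pow_eq_pow_mod k (h.pow_eq_one hU hn)]
  exact hA ⟨(i, ⟨k % (U * n), Nat.mod_lt _ (Nat.mul_pos hU hn)⟩), rfl⟩

theorem codeword_one_ne_zero (h : IsSuitable U n K L σ p) (hn : 0 < n) (M : ℤ) (j : Fin U) :
    codeword σ p M j (fun _ : Fin n => 1) ≠ 0 := by
  have hp0 : ((p : K) : ℂ) ≠ 0 := norm_pos_iff.1 (one_pos.trans_le h.one_le_norm)
  intro h0
  have := congrFun (congrFun h0 ⟨0, hn⟩) (j, ⟨0, hn⟩)
  rw [codeword_apply] at this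
  have hz : ((p : K) : ℂ) ^ M = 0 := by simpa [regularMatrix] using this
  exact zpow_ne_zero _ hp0 hz

/-- Needed for the decay to be attained: the infimum of an empty set of reals would be 0. -/
theorem basis_ne_zero (h : IsSuitable U n K L σ p) (hn : 0 < n) {M : ℤ} {r : ℕ} {j : Fin U}
    (B : Module.Basis (Fin r) ℤ (userLattice U n σ p M j)) :
    ∃ s, (B s : Matrix (Fin n) (Fin U × Fin n) ℂ) ≠ 0 := by
  have hmem : codeword σ p M j (fun _ : Fin n => 1) ∈ userLattice U n σ p M j := ⟨_, rfl⟩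
  have : Nontrivial (userLattice U n σ p M j) :=
    ⟨⟨_, hmem⟩, 0, fun h0 => codeword_one_ne_zero h hn M j (congrArg Subtype.val h0)⟩
  obtain ⟨s⟩ := B.index_nonempty
  exact ⟨s, fun h0 => B.ne_zero s (Subtype.ext h0)⟩

theorem IsSuitable.exists_pos_le_decay (h : IsSuitable U n K L σ p) (hU : 0 < U) (hn : 0 < n)
    {m : ℤ} (hm : (U : ℝ) * ((n : ℝ) - 1) / 2 < (m : ℝ)) {r : ℕ}
    (B : ∀ j : Fin U, Module.Basis (Fin r) ℤ (userLattice U n σ p m j)) (I : Finset (Fin U)) :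
    ∃ C : ℝ, 0 < C ∧ ∀ N : I → ℝ, (∀ i, 1 ≤ N i) →
      (C / (∏ i, N i) ^ ((U - 1) * n) ≤
        decay (fun j s => (B j s : Matrix (Fin n) (Fin U × Fin n) ℂ)) I N) ∧
      (I.card = 1 → C ≤ decay (fun j s => (B j s : Matrix (Fin n) (Fin U × Fin n) ℂ)) I N) := by
  have hn1 : (1 : ℝ) ≤ n := by exact_mod_cast hn
  have hm0 : 0 ≤ m := by
    have : (0 : ℝ) ≤ (U : ℝ) * ((n : ℝ) - 1) / 2 :=
      div_nonneg (mul_nonneg (Nat.cast_nonneg _) (sub_nonneg.2 hn1)) zero_le_two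
    exact_mod_cast (this.trans_lt hm).le
  obtain ⟨M, rfl⟩ := Int.eq_ofNat_of_zero_le hm0
  have hM : Fintype.card I * (n - 1) < 2 * M := by
    have h1 : (U : ℝ) * ((n - 1 : ℕ) : ℝ) < 2 * M := by
      rw [Nat.cast_sub hn, Nat.cast_one]
      rw [Int.cast_natCast] at hm
      linarith
    have h2 : U * (n - 1) < 2 * M := by exact_mod_cast h1
    refine lt_of_le_of_lt (Nat.mul_le_mul_right _ ?_) h2
    simpa using Finset.card_le_univ I
  choose b hb using fun j s => (B j s).2
  have hB : (fun j s => (B j s : Matrix (Fin n) (Fin U × Fin n) ℂ)) =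
      fun j s => codeword σ p M j (b j s) := funext fun j => funext fun s => (hb j s).symm
  obtain ⟨A, hA0, hA⟩ := h.exists_norm_bound hU hn
    fun a : Fin U × Fin r × Fin n => b a.1 a.2.1 a.2.2
  set P : ℝ := ‖((p : K) : ℂ)‖ with hP
  have hP1 : 1 ≤ P := h.one_le_norm
  set c := Fintype.card (I × Fin n) with hc
  set S : ℝ := r * A + 1 with hS
  have hS0 : 0 < S := by positivity
  -- `G` bounds the conjugates of d when all N i = 1; `C₁` also pays for the factor p^M taken into
  -- each of the `c` rows.
  set G : ℝ := c.factorial * ((P ^ (M + 1)) ^ c * (S ^ Fintype.card I) ^ n) with hG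
  have hG0 : 0 < G := by positivity
  set C₁ : ℝ := ((P ^ M) ^ c * G ^ (U - 1))⁻¹ with hC₁
  have hC₁0 : 0 < C₁ := by positivity
  refine ⟨min C₁ (P ^ (M * n))⁻¹, by positivity, fun N hN => ?_⟩
  have hmem := (isLeast_decay (fun j s => (B j s : Matrix (Fin n) (Fin U × Fin n) ℂ)) I N hN
    fun i => basis_ne_zero h hn (B i)).1
  generalize decay (fun j s => (B j s : Matrix (Fin n) (Fin U × Fin n) ℂ)) I N = D at hmem
  rw [hB] at hmem
  obtain ⟨X, hX, hD⟩ := hmem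
  choose x hXx hx0 hx using fun i : I => exists_codeword_of_mem_finiteCode
    (fun s l k => hA ((i : Fin U), s, l) k) (zero_le_one.trans (hN i)) (hX i).1 (hX i).2
  obtain rfl : X = fun i : I => codeword σ p M (i : Fin U) (x i) := funext hXx
  refine ⟨(div_le_div_of_nonneg_right (min_le_left _ _) ?_).trans ?_, fun hI => ?_⟩
  · exact pow_nonneg (Finset.prod_nonneg fun i _ => zero_le_one.trans (hN i)) _
  · have hT : ∀ i k l, ‖integerEmb ((integerAut σ ^ k) (x i l))‖ ≤ N i * S := fun i k l =>
      (hx i k l).trans (mul_le_mul_of_nonneg_left (le_add_of_nonneg_right zero_le_one)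
        (zero_le_one.trans (hN i)))
    have h1 := h.one_le_norm_det_minorMatrix_mul hU hn (fun i : I => (i : ℕ)) hM hx0 hT
    have he : Function.Injective fun a : I × Fin n => ((a.1 : Fin U), a.2) := fun a b hab =>
      Prod.ext (Subtype.ext (congrArg (fun y : Fin U × Fin n => y.1) hab))
        (congrArg (fun y : Fin U × Fin n => y.2) hab)
    have h2 := norm_det_minor_le_sqrt (fun i : I => codeword σ p M (i : Fin U) (x i)) he
    rw [← hD] at h2
    rw [← h.pow_mul_det_minor, norm_mul, norm_pow, norm_pow, Finset.prod_mul_distrib,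
      Finset.prod_const, Finset.card_univ] at h1
    have hprod : 0 < ∏ i, N i := Finset.prod_pos fun i _ => one_pos.trans_le (hN i)
    rw [hC₁, ← one_div, div_div, div_le_iff₀ (by positivity)]
    refine h1.trans ?_
    refine le_trans (mul_le_mul_of_nonneg_right (mul_le_mul_of_nonneg_left h2 (by positivity))
      (by positivity)) (le_of_eq ?_)
    rw [hG, mul_comm (U - 1) n, pow_mul, mul_pow (∏ i, N i)]
    ring
  · rw [hD]
    exact (min_le_right _ _).trans (h.sqrt_det_of_card_eq_one hU hn M hI hx0)

end Decay

end MacCode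

theorem mainTheorem2 (U n : ℕ) (hU : 0 < U) (hn : 0 < n)
    (K : IntermediateField ℚ ℂ) [NumberField K] (L : IntermediateField K ℂ)
    (σ : L ≃ₐ[K] L) (p : NumberField.RingOfIntegers K)
    (hsuit : MacCode.IsSuitable U n K L σ p)
    (m : ℤ) (hm : (U : ℝ) * ((n : ℝ) - 1) / 2 < (m : ℝ))
    (r : ℕ) (B : ∀ j : Fin U, Module.Basis (Fin r) ℤ (MacCode.userLattice U n σ p m j)) :
    ∃ C : ℝ, 0 < C ∧ ∀ I : Finset (Fin U), I.Nonempty →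
      (∀ N : I → ℝ, (∀ i, 1 ≤ N i) →
        (1 < I.card →
          C / (∏ i, N i) ^ ((U - 1) * n) ≤
            MacCode.decay (fun j s => (B j s : Matrix (Fin n) (Fin U × Fin n) ℂ)) I N) ∧
        (I.card = 1 →
          C ≤ MacCode.decay (fun j s => (B j s : Matrix (Fin n) (Fin U × Fin n) ℂ)) I N)) ∧
      (∀ N : ℝ, 1 ≤ N →
        (1 < I.card →
          C / N ^ (I.card * (U - 1) * n) ≤
            MacCode.decay (fun j s => (B j s : Matrix (Fin n) (Fin U × Fin n) ℂ)) I
              (fun _ => N)) ∧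
        (I.card = 1 →
          C ≤ MacCode.decay (fun j s => (B j s : Matrix (Fin n) (Fin U × Fin n) ℂ)) I
            (fun _ => N))) := by

  choose C hC0 hC using hsuit.exists_pos_le_decay hU hn hm B
  -- There are finitely many sets of users, so the smallest of their constants serves for all.
  obtain ⟨I₀, hI₀⟩ := Finite.exists_min C
  refine ⟨C I₀, hC0 I₀, fun I _ => ?_⟩
  have key : ∀ N : I → ℝ, (∀ i, 1 ≤ N i) →
      (1 < I.card →
        C I₀ / (∏ i, N i) ^ ((U - 1) * n) ≤
          MacCode.decay (fun j s => (B j s : Matrix (Fin n) (Fin U × Fin n) ℂ)) I N) ∧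
      (I.card = 1 →
        C I₀ ≤ MacCode.decay (fun j s => (B j s : Matrix (Fin n) (Fin U × Fin n) ℂ)) I N) := by
    refine fun N hN => ⟨fun _ => le_trans ?_ (hC I N hN).1, fun h => (hI₀ I).trans ((hC I N hN).2 h)⟩
    exact div_le_div_of_nonneg_right (hI₀ I)
      (pow_nonneg (Finset.prod_nonneg fun i _ => zero_le_one.trans (hN i)) _)
  refine ⟨key, fun N hN => ?_⟩
  have := key (fun _ => N) fun _ => hN
  rwa [Finset.prod_const, Finset.card_univ, Fintype.card_coe, ← pow_mul, ← mul_assoc] at this
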